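/- **Proposition (Composition formula).** Let $G$ be a connected simply connected real Lie group with Lie algebra $\mathfrak g$ such that the exponential map $\exp:\mathfrak g\to G$ is a homeomorphism. Fix a frame (a basis) $X_1,\dots,X_N$ of $\mathfrak g$, and let $\mu$ be a left Haar measure of $G$ transferred to $\mathbb R^N\cong\mathfrak g$ by $x\mapsto\exp(\sum_j x_jX_j)$. Let $\mathrm{CH}$ be the Campbell–Hausdorff group law in exponential coordinates, i.e. $\exp\big(\sum_j \mathrm{CH}[x,y]_jX_j\big)=\exp\big(\sum_j x_jX_j\big)\exp\big(\sum_j y_jX_j\big)$ for $x,y\in\mathbb R^N$. Let $\mathfrak g$ be represented by self-adjoint (possibly unbounded) operators on a complex Banach space $V$. This means that there is a strongly continuous representation $T$ of $G$ by isometries of $V$ (by unitary operators, if $V$ is a Hilbert space) such that each $X\in\mathfrak g$ acts as the operator $Xf=\lim_{t\to0}\frac{T(\exp tX)f-f}{it}$, with domain the set of all $f$ for which the limit exists. For $X\in\mathfrak g$ let $e^{iX}$ be the value at $t=1$ of the strongly continuous one-parameter group of isometries of $V$ generated by this operator in the same sense. For $\kappa\in L^1(\mathbb R^N,\mu)$ put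 $$\operatorname{Op}(\kappa)f=(2\pi)^{-N/2}\int_{\mathbb R^N}\kappa(x)\,e^{i\sum_jx_jX_j}f\,d\mu(x),\qquad f\in V.$$ The relative convolution with kernel $k\in L^1(\mathbb R^N,dy)$ such that $\widehat k\in L^1(\mu)$ is $\operatorname{Op}(\widehat k)$, where $\widehat k(x)=(2\pi)^{-N/2}\int_{\mathbb R^N} k(y)e^{-iy\cdot x}\,dy$. 1. Let $\kappa_1,\kappa_2\in L^1(\mu)$. Then the integral $$(\kappa_2*\kappa_1)(x)=(2\pi)^{-N/2}\int_{\mathbb R^N}\kappa_2(y)\,\kappa_1(\mathrm{CH}[-y,x])\,d\mu(y)$$ converges absolutely for $\mu$-almost every $x$, the function $\kappa_2*\kappa_1$ belongs to $L^1(\mu)$, the integrals defining $\operatorname{Op}(\kappa_1)f$, $\operatorname{Op}(\kappa_2)f$ and $\operatorname{Op}(\kappa_2*\kappa_1)f$ converge absolutely for every $f\in V$, and $$\operatorname{Op}(\kappa_2)\operatorname{Op}(\kappa_1)=\operatorname{Op}(\kappa_2*\kappa_1).$$ 2. Consequently, if $k_1,k_2,k\in L^1(\mathbb R^N,dy)$,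 $\widehat k_1,\widehat k_2\in L^1(\mu)$ and $\widehat k=\widehat k_2*\widehat k_1$ $\mu$-almost everywhere, then the composition of the relative convolution with kernel $k_2$ and the relative convolution with kernel $k_1$ (applied first) is the relative convolution with kernel $k$. -/

import Mathlib

open MeasureTheory Filter Topology
open scoped Manifold ContDiff

noncomputable section

namespace RelConv

section LieGroup

variable {E : Type*} [NormedAddCommGroup E] [NormedSpace ℝ E]
  {G : Type*} [TopologicalSpace G] [ChartedSpace E G] [Group G]

/-- The exponential map of a Lie group: `lieExp X = γ 1`, where `γ` is the integral curve, with
`γ 0 = 1`, of the left invariant vector field whose value at the identity is `X`. On a Lie group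
such a curve exists and is unique. -/
def lieExp (X : GroupLieAlgebra 𝓘(ℝ, E) G) : G :=
  open Classical in
  if h : ∃ γ : ℝ → G, γ 0 = 1 ∧ IsMIntegralCurve (I := 𝓘(ℝ, E)) γ (mulInvariantVectorField X)
  then h.choose 1 else 1

variable {N : ℕ} (b : Module.Basis (Fin N) ℝ (GroupLieAlgebra 𝓘(ℝ, E) G))

/-- The element `∑ j, x j • X j` of the Lie algebra with coordinates `x` in the frame `b`. -/
def ofCoord (x : Fin N → ℝ) : GroupLieAlgebra 𝓘(ℝ, E) G := ∑ j, x j • b j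

/-- The point of the group with exponential coordinates `x`. -/
def expCoord (x : Fin N → ℝ) : G := lieExp (ofCoord b x)

/-- The Campbell-Hausdorff product: the group law in exponential coordinates, characterised (when
the exponential map is bijective) by `expCoord b (CH b x y) = expCoord b x * expCoord b y`. -/
def CH (x y : Fin N → ℝ) : Fin N → ℝ :=
  Function.invFun (expCoord b) (expCoord b x * expCoord b y)

/-- The invariant measure on the coordinate space `ℝ^N` of the Lie algebra: the (left) Haar measure
`η` of the group, transferred by the exponential map. -/
def invMeasure [MeasurableSpace G] (η : Measure G) : Measure (Fin N → ℝ) :=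
  η.comap (expCoord b)

end LieGroup

section Operators

variable {V : Type*} [NormedAddCommGroup V] [NormedSpace ℂ V]

/-- A strongly continuous one-parameter group of isometries of `V`
(of unitary operators, if `V` is a Hilbert space). -/
structure IsIsometricGroup (U : ℝ → V →L[ℂ] V) : Prop where
  zero : U 0 = ContinuousLinearMap.id ℂ V
  add : ∀ s t, U (s + t) = (U s).comp (U t)
  norm_eq : ∀ t f, ‖U t f‖ = ‖f‖
  continuous : ∀ f, Continuous fun t => U t f

/-- The unbounded operator `A` is the generator of `U`, that is `A f = lim (U t f - f) / (i t)` as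
`t → 0`, the domain of `A` being exactly the set of all `f` for which the limit exists. -/
def IsGenerator (A : V →ₗ.[ℂ] V) (U : ℝ → V →L[ℂ] V) : Prop :=
  ∀ f g : V, (f, g) ∈ A.graph ↔
    Tendsto (fun t : ℝ => (Complex.I * (t : ℂ))⁻¹ • (U t f - f)) (𝓝[≠] 0) (𝓝 g)

/-- Self-adjointness of an (in general unbounded) operator of a Banach space: `A` generates a
strongly continuous group of isometries `t ↦ exp (i t A)`. If `V` is a Hilbert space then, by
Stone's theorem, this is self-adjointness in the usual sense. -/
def IsSelfAdjointOp (A : V →ₗ.[ℂ] V) : Prop :=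
  ∃ U : ℝ → V →L[ℂ] V, IsIsometricGroup U ∧ IsGenerator A U

/-- The operator `exp (i A)` for a self-adjoint `A`: the value at time `1` of the (unique) strongly
continuous group of isometries with generator `A`. -/
def expI (A : V →ₗ.[ℂ] V) : V →L[ℂ] V :=
  open Classical in
  if h : IsSelfAdjointOp A then h.choose 1 else 0

variable {E : Type*} [NormedAddCommGroup E] [NormedSpace ℝ E]
  {G : Type*} [TopologicalSpace G] [ChartedSpace E G] [Group G]

/-- A self-adjoint representation of the Lie algebra of `G`, that is the differential of a strongly
continuous representation `T` of `G` by isometries (by unitary operators, if `V` is a Hilbert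
space): each `A X` is the self-adjoint generator of `t ↦ T (lieExp (t X))`. -/
def IsSelfAdjointRep (A : GroupLieAlgebra 𝓘(ℝ, E) G → V →ₗ.[ℂ] V) : Prop :=
  ∃ T : G →* (V →L[ℂ] V), (∀ g f, ‖T g f‖ = ‖f‖) ∧ (∀ f, Continuous fun g => T g f) ∧
    ∀ X, IsGenerator (A X) fun t : ℝ => T (lieExp (t • X))

variable {N : ℕ} (b : Module.Basis (Fin N) ℝ (GroupLieAlgebra 𝓘(ℝ, E) G))

/-- The normalising constant `(2π)^(-N/2)`. -/
def cst (N : ℕ) : ℂ := (((2 * Real.pi) ^ (-(N : ℝ) / 2) : ℝ) : ℂ)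

/-- The Fourier transform `(2π)^(-N/2) ∫ k(y) exp (-i y·x) dy` on `ℝ^N`
(with respect to Lebesgue measure). -/
def fourier (k : (Fin N → ℝ) → ℂ) (x : Fin N → ℝ) : ℂ :=
  cst N * ∫ y, k y * Complex.exp (-Complex.I * ((∑ j, y j * x j : ℝ) : ℂ))

/-- The integrand `κ(x) exp (i ∑ x_j X_j) f`, where `∑ x_j X_j` is the operator representing the
element of the Lie algebra with coordinates `x`. -/
def integrand (A : GroupLieAlgebra 𝓘(ℝ, E) G → V →ₗ.[ℂ] V) (κ : (Fin N → ℝ) → ℂ) (f : V)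
    (x : Fin N → ℝ) : V :=
  κ x • expI (A (ofCoord b x)) f

/-- The operator `(2π)^(-N/2) ∫ κ(x) exp (i ∑ x_j X_j) dμ(x)`, as a strong integral. -/
def expIntegral (μ : Measure (Fin N → ℝ)) (A : GroupLieAlgebra 𝓘(ℝ, E) G → V →ₗ.[ℂ] V)
    (κ : (Fin N → ℝ) → ℂ) (f : V) : V :=
  cst N • ∫ x, integrand b A κ f x ∂μ

/-- The operator of relative convolution
`(2π)^(-N/2) ∫ k̂(x) exp (i ∑ x_j X_j) dμ(x)` with kernel `k`. -/
def relativeConvolution (μ : Measure (Fin N → ℝ)) (A : GroupLieAlgebra 𝓘(ℝ, E) G → V →ₗ.[ℂ] V)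
    (k : (Fin N → ℝ) → ℂ) (f : V) : V :=
  expIntegral b μ A (fourier k) f

/-- `(κ₂ * κ₁)(x) = (2π)^(-N/2) ∫ κ₂(y) κ₁(CH[-y, x]) dμ(y)`. -/
def convCH (μ : Measure (Fin N → ℝ)) (κ₂ κ₁ : (Fin N → ℝ) → ℂ) (x : Fin N → ℝ) : ℂ :=
  cst N * ∫ y, κ₂ y * κ₁ (CH b (-y) x) ∂μ

end Operators

end RelConv

end

/-!
The idea is that `expIntegral` is the integrated form of the representation `T` of `G`, written in
exponential coordinates, and that integrated representations turn convolution into composition.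

The curve `t ↦ lieExp (t • X)` is a one-parameter subgroup (`lieExp_add_smul`), since left invariant
vector fields are complete and their integral curves are unique. Hence `t ↦ T (lieExp (t • X))` is a
strongly continuous group of isometries with generator `A X`. Such a group is determined by its
generator (`IsIsometricGroup.eq_of_hasDerivAt`), so that `expI (A X) = T (lieExp X)`
(`expI_eq_rep`). The same subgroup property gives `expCoord b (-x) = (expCoord b x)⁻¹`, by which
`CH b (-y) x` has group coordinate `(expCoord b y)⁻¹ * expCoord b x`.

Since `expCoord b` is a homeomorphism carrying `invMeasure b η` to `η`
(`measurePreserving_expCoord`), all the integrals are integrals over `G`. There the identity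
`∫ κ₂ y • T y (∫ κ₁ x • T x f) = ∫ (∫ κ₂ y * κ₁ (y⁻¹ * x)) • T x f` is Fubini's theorem combined
with the left invariance of `η` (`integral_smul_rep_integral_smul_rep`).
-/

namespace RelConv

/-! ### One-parameter subgroups -/

section OneParameter

variable {E : Type*} [NormedAddCommGroup E] [NormedSpace ℝ E]
  {G : Type*} [TopologicalSpace G] [ChartedSpace E G] [Group G] [LieGroup 𝓘(ℝ, E) 3 G]

theorem contMDiff_mulInvariantVectorField_one (X : GroupLieAlgebra 𝓘(ℝ, E) G) :
    ContMDiff 𝓘(ℝ, E) (𝓘(ℝ, E).prod 𝓘(ℝ, E)) 1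
      (fun g : G => (⟨g, mulInvariantVectorField X g⟩ : TangentBundle 𝓘(ℝ, E) G)) := by
  have h3 : LieGroup 𝓘(ℝ, E) (minSmoothness ℝ 3) G := by simpa using ‹LieGroup 𝓘(ℝ, E) 3 G›
  exact (contMDiff_mulInvariantVectorField X).of_le
    ((by norm_num : (1 : WithTop ℕ∞) ≤ 2).trans le_minSmoothness)

theorem mdifferentiable_const_mul (g : G) :
    MDifferentiable 𝓘(ℝ, E) 𝓘(ℝ, E) (fun h : G => g * h) :=
  (contMDiff_mul_left (I := 𝓘(ℝ, E)) (n := 3)).mdifferentiable (by norm_num)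

theorem mulInvariantVectorField_mul (X : GroupLieAlgebra 𝓘(ℝ, E) G) (g h : G) :
    mulInvariantVectorField X (g * h) =
      mfderiv 𝓘(ℝ, E) 𝓘(ℝ, E) (fun a : G => g * a) h (mulInvariantVectorField X h) := by
  have hc : (fun a : G => g * h * a) = (fun a => g * a) ∘ fun a => h * a := by
    ext a; simp [mul_assoc]
  have h1 := mfderiv_comp (I := 𝓘(ℝ, E)) (I' := 𝓘(ℝ, E)) (I'' := 𝓘(ℝ, E)) (1 : G)
    (mdifferentiable_const_mul (E := E) g (h * 1)) (mdifferentiable_const_mul (E := E) h 1)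
  rw [← hc] at h1
  unfold mulInvariantVectorField
  rw [h1]
  change (mfderiv 𝓘(ℝ, E) 𝓘(ℝ, E) (fun a : G => g * a) (h * 1) : E →L[ℝ] E) _ = _
  rw [mul_one]
  rfl

theorem isMIntegralCurve_const_mul {X : GroupLieAlgebra 𝓘(ℝ, E) G} {γ : ℝ → G} {s : Set ℝ}
    (hγ : IsMIntegralCurveOn (I := 𝓘(ℝ, E)) γ (mulInvariantVectorField X) s) (g : G) :
    IsMIntegralCurveOn (I := 𝓘(ℝ, E)) (fun t => g * γ t) (mulInvariantVectorField X) s := by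
  intro t ht
  have h := (mdifferentiable_const_mul (E := E) g (γ t)).hasMFDerivAt.comp_hasMFDerivWithinAt t
    (hγ t ht)
  refine h.congr_mfderiv ?_
  rw [mulInvariantVectorField_mul]
  set L : E →L[ℝ] E := mfderiv 𝓘(ℝ, E) 𝓘(ℝ, E) (fun a : G => g * a) (γ t)
  exact ContinuousLinearMap.ext fun r : ℝ => L.map_smul r _

variable [T2Space G]

theorem lieExp_eq_of_isMIntegralCurve {X : GroupLieAlgebra 𝓘(ℝ, E) G} {γ : ℝ → G}
    (h0 : γ 0 = 1) (hγ : IsMIntegralCurve (I := 𝓘(ℝ, E)) γ (mulInvariantVectorField X)) :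
    lieExp X = γ 1 := by
  have : IsManifold 𝓘(ℝ, E) 1 G := IsManifold.of_le (n := 3) (by norm_num)
  have hex : ∃ γ : ℝ → G, γ 0 = 1 ∧
      IsMIntegralCurve (I := 𝓘(ℝ, E)) γ (mulInvariantVectorField X) := ⟨γ, h0, hγ⟩
  rw [lieExp, dif_pos hex]
  exact congrFun (isMIntegralCurve_Ioo_eq_of_contMDiff_boundaryless (t₀ := 0)
    (contMDiff_mulInvariantVectorField_one X) hex.choose_spec.2 hγ
    (by rw [hex.choose_spec.1, h0])) 1

theorem lieExp_smul_eq_of_isMIntegralCurve {X : GroupLieAlgebra 𝓘(ℝ, E) G} {γ : ℝ → G}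
    (h0 : γ 0 = 1) (hγ : IsMIntegralCurve (I := 𝓘(ℝ, E)) γ (mulInvariantVectorField X)) (s : ℝ) :
    lieExp (s • X) = γ s := by
  have h := hγ.comp_mul s
  have hs : s • mulInvariantVectorField (I := 𝓘(ℝ, E)) X =
      mulInvariantVectorField (I := 𝓘(ℝ, E)) (G := G) (s • X) :=
    (mulInvariantVectorField_smul s X).symm
  rw [hs] at h
  rw [lieExp_eq_of_isMIntegralCurve (γ := γ ∘ (· * s)) (by simp [h0]) h]
  simp

variable [CompleteSpace E]

/-- Left invariant vector fields are complete: left translates of one local integral curve through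
the identity exist for the same time through every point. -/
theorem exists_isMIntegralCurve_mulInvariantVectorField (X : GroupLieAlgebra 𝓘(ℝ, E) G) :
    ∃ γ : ℝ → G, γ 0 = 1 ∧ IsMIntegralCurve (I := 𝓘(ℝ, E)) γ (mulInvariantVectorField X) := by
  have : IsManifold 𝓘(ℝ, E) 1 G := IsManifold.of_le (n := 3) (by norm_num)
  have hv := contMDiff_mulInvariantVectorField_one X
  obtain ⟨γ, h1, hγ⟩ := exists_isMIntegralCurveAt_of_contMDiffAt_boundaryless (t₀ := 0)
    (hv.contMDiffAt (x := (1 : G)))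
  obtain ⟨ε, hε, hγ⟩ := isMIntegralCurveAt_iff'.mp hγ
  rw [Real.ball_eq_Ioo, zero_sub, zero_add] at hγ
  exact exists_isMIntegralCurve_of_isMIntegralCurveOn hv hε
    (fun g => ⟨fun t => g * γ t, by simp [h1], isMIntegralCurve_const_mul hγ g⟩) 1

theorem lieExp_zero : (lieExp (0 : GroupLieAlgebra 𝓘(ℝ, E) G) : G) = 1 := by
  obtain ⟨γ, h0, hγ⟩ :=
    exists_isMIntegralCurve_mulInvariantVectorField (0 : GroupLieAlgebra 𝓘(ℝ, E) G)
  simpa [h0] using lieExp_smul_eq_of_isMIntegralCurve h0 hγ 0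

/-- `t ↦ lieExp (t • X)` is a one-parameter subgroup: by left invariance `γ (s + ·)` and `γ s * γ ·`
are integral curves with the same value at `0`. -/
theorem lieExp_add_smul (X : GroupLieAlgebra 𝓘(ℝ, E) G) (s t : ℝ) :
    (lieExp ((s + t) • X) : G) = lieExp (s • X) * lieExp (t • X) := by
  have : IsManifold 𝓘(ℝ, E) 1 G := IsManifold.of_le (n := 3) (by norm_num)
  obtain ⟨γ, h0, hγ⟩ := exists_isMIntegralCurve_mulInvariantVectorField X
  simp only [lieExp_smul_eq_of_isMIntegralCurve h0 hγ]
  have h1 : IsMIntegralCurve (I := 𝓘(ℝ, E)) (fun t => γ s * γ t) (mulInvariantVectorField X) :=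
    isMIntegralCurve_iff_isMIntegralCurveOn.mpr
      (isMIntegralCurve_const_mul (hγ.isMIntegralCurveOn _) _)
  have h2 := congrFun (isMIntegralCurve_Ioo_eq_of_contMDiff_boundaryless (t₀ := 0)
    (contMDiff_mulInvariantVectorField_one X) (hγ.comp_add s) h1 (by simp [h0])) t
  simpa [add_comm] using h2

theorem lieExp_neg (X : GroupLieAlgebra 𝓘(ℝ, E) G) :
    (lieExp (-X) : G) = (lieExp X)⁻¹ := by
  have h := lieExp_add_smul X (-1) 1
  simp only [neg_add_cancel, zero_smul, lieExp_zero, neg_smul, one_smul] at h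
  exact eq_inv_of_mul_eq_one_left h.symm

theorem continuous_lieExp_smul (X : GroupLieAlgebra 𝓘(ℝ, E) G) :
    Continuous fun t : ℝ => (lieExp (t • X) : G) := by
  obtain ⟨γ, h0, hγ⟩ := exists_isMIntegralCurve_mulInvariantVectorField X
  simpa only [lieExp_smul_eq_of_isMIntegralCurve h0 hγ] using hγ.continuous

end OneParameter

/-! ### A group of isometries is determined by its generator -/

section Generator

variable {V : Type*} [NormedAddCommGroup V] [NormedSpace ℂ V] {U W : ℝ → V →L[ℂ] V}

/-- The generator, defined with the factor `i⁻¹`, expressed by the plain derivative of the orbit. -/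
theorem tendsto_generator_iff_hasDerivAt (h0 : U 0 = ContinuousLinearMap.id ℂ V) {f g : V} :
    Tendsto (fun t : ℝ => (Complex.I * (t : ℂ))⁻¹ • (U t f - f)) (𝓝[≠] 0) (𝓝 g) ↔
      HasDerivAt (fun t => U t f) (Complex.I • g) 0 := by
  rw [hasDerivAt_iff_tendsto_slope_zero,
    ← tendsto_const_smul_iff₀ (c := Complex.I) Complex.I_ne_zero]
  refine tendsto_congr fun t => ?_
  rw [zero_add, h0, ContinuousLinearMap.id_apply, smul_smul, mul_inv,
    mul_inv_cancel_left₀ Complex.I_ne_zero, ← Complex.ofReal_inv, Complex.coe_smul]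

/-- Joint strong continuity, a consequence of the isometry of the operators. -/
theorem IsIsometricGroup.tendsto_apply (hU : IsIsometricGroup U) {α : Type*} {l : Filter α}
    {t : α → ℝ} {v : α → V} {t₀ : ℝ} {v₀ : V} (ht : Tendsto t l (𝓝 t₀))
    (hv : Tendsto v l (𝓝 v₀)) : Tendsto (fun a => U (t a) (v a)) l (𝓝 (U t₀ v₀)) := by
  have h1 : Tendsto (fun a => U (t a) (v a - v₀)) l (𝓝 0) := by
    rw [tendsto_zero_iff_norm_tendsto_zero]
    simp only [hU.norm_eq]
    exact tendsto_zero_iff_norm_tendsto_zero.mp (by simpa using hv.sub_const v₀)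
  simpa using h1.add (((hU.continuous v₀).tendsto t₀).comp ht)

theorem IsIsometricGroup.hasDerivAt_apply (hU : IsIsometricGroup U) {f g : V}
    (h : HasDerivAt (fun t => U t f) g 0) (s : ℝ) : HasDerivAt (fun t => U t f) (U s g) s := by
  rw [hasDerivAt_iff_tendsto_slope_zero] at h ⊢
  refine (((U s).continuous.tendsto g).comp h).congr fun t => ?_
  simp [hU.add, hU.zero]

theorem IsIsometricGroup.hasDerivAt_zero_apply (hU : IsIsometricGroup U) {f g : V}
    (h : HasDerivAt (fun t => U t f) g 0) (s : ℝ) :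
    HasDerivAt (fun t => U t (U s f)) (U s g) 0 := by
  have := (hU.hasDerivAt_apply h (0 + s)).comp_add_const 0 s
  simpa [hU.add] using this

/-- The averages `ε⁻¹ ∫₀^ε U s f ds` lie in the domain of the generator and tend to `f`. -/
theorem IsIsometricGroup.dense_differentiable [CompleteSpace V] (hU : IsIsometricGroup U) :
    Dense {f : V | ∃ g, HasDerivAt (fun t => U t f) g 0} := by
  intro f
  set F : ℝ → V := fun x => ∫ s in (0 : ℝ)..x, U s f with hF
  have hc := hU.continuous f
  have hFd (x : ℝ) : HasDerivAt F (U x f) x := hc.integral_hasStrictDerivAt 0 x |>.hasDerivAt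
  have hlim : Tendsto (fun ε : ℝ => ε⁻¹ • F ε) (𝓝[≠] 0) (𝓝 f) := by
    simpa [hF, hU.zero] using hasDerivAt_iff_tendsto_slope_zero.mp (hFd 0)
  refine mem_closure_of_tendsto hlim (Eventually.of_forall fun ε => ?_)
  have heq (t : ℝ) : U t (ε⁻¹ • F ε) = ε⁻¹ • (F (t + ε) - F t) := by
    have h1 : U t (F ε) = ∫ s in (0 : ℝ)..ε, U (t + s) f := by
      rw [hF, ← ContinuousLinearMap.intervalIntegral_comp_comm _ (hc.intervalIntegrable _ _)]
      simp [hU.add]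
    rw [ContinuousLinearMap.map_smul_of_tower, h1,
      intervalIntegral.integral_comp_add_left (fun s => U s f), hF,
      intervalIntegral.integral_interval_sub_left (hc.intervalIntegrable _ _)
        (hc.intervalIntegrable _ _), add_zero]
  refine ⟨ε⁻¹ • (U (0 + ε) f - U 0 f), ?_⟩
  simp only [heq]
  exact (((hFd (0 + ε)).comp_add_const 0 ε).sub (hFd 0)).const_smul ε⁻¹

/-- On the domain of the generator `s ↦ W (t - s) (U s f)` has derivative zero, so its values at
`0` and `t` agree. -/
theorem IsIsometricGroup.eq_of_hasDerivAt [CompleteSpace V] (hU : IsIsometricGroup U)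
    (hW : IsIsometricGroup W) (h : ∀ f g : V, HasDerivAt (fun t => U t f) g 0 →
      HasDerivAt (fun t => W t f) g 0) : U = W := by
  ext t f
  refine congrFun (f := fun f => U t f) (g := fun f => W t f) ?_ f
  refine Continuous.ext_on hU.dense_differentiable (U t).continuous (W t).continuous ?_
  rintro f ⟨g, hg⟩
  have hd (s : ℝ) : HasDerivAt (fun s => W (t - s) (U s f)) 0 s := by
    have hUs := hU.hasDerivAt_apply hg s
    have hWs := (hW.hasDerivAt_apply (h _ _ (hU.hasDerivAt_zero_apply hg s)) (t - s)).comp_const_sub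
      t s
    -- `W` is only strongly continuous, so the product rule is checked on difference quotients.
    rw [hasDerivAt_iff_tendsto_slope_zero] at hUs hWs ⊢
    have ht : Tendsto (fun r : ℝ => t - (s + r)) (𝓝[≠] 0) (𝓝 (t - s)) := by
      have : Tendsto (fun r : ℝ => t - (s + r)) (𝓝 0) (𝓝 (t - (s + 0))) :=
        (by fun_prop : Continuous fun r : ℝ => t - (s + r)).tendsto 0
      rw [add_zero] at this
      exact this.mono_left nhdsWithin_le_nhds
    have h3 := (hW.tendsto_apply ht hUs).add hWs
    rw [add_neg_cancel] at h3
    refine h3.congr fun r => ?_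
    rw [ContinuousLinearMap.map_smul_of_tower, ← smul_add, map_sub, sub_add_sub_cancel]
  have hconst := is_const_of_deriv_eq_zero (fun s => (hd s).differentiableAt)
    (fun s => (hd s).deriv) t 0
  simpa [hU.zero, hW.zero] using hconst

/-- The value of `expI` does not depend on the group chosen in its definition. -/
theorem expI_eq [CompleteSpace V] {A : V →ₗ.[ℂ] V} (hU : IsIsometricGroup U)
    (hA : IsGenerator A U) : expI A = U 1 := by
  have hex : IsSelfAdjointOp A := ⟨U, hU, hA⟩
  rw [expI, dif_pos hex]
  obtain ⟨hW, hAW⟩ := hex.choose_spec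
  refine congrFun (hW.eq_of_hasDerivAt hU fun f g hg => ?_) 1
  have hg' : Complex.I • (Complex.I⁻¹ • g) = g := smul_inv_smul₀ Complex.I_ne_zero g
  rw [← hg', ← tendsto_generator_iff_hasDerivAt hW.zero, ← hAW] at hg
  rwa [← hg', ← tendsto_generator_iff_hasDerivAt hU.zero, ← hA]

end Generator

/-! ### Convolution on a group and integrated representations -/

section Convolution

variable {G : Type*} [Group G] [TopologicalSpace G] [SecondCountableTopology G]
  [MeasurableSpace G] [BorelSpace G] {η : Measure G}
  {V : Type*} [NormedAddCommGroup V] [NormedSpace ℂ V] {T : G →* (V →L[ℂ] V)}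

theorem integrable_smul_rep (hT : ∀ g f, ‖T g f‖ = ‖f‖) (hc : ∀ f, Continuous fun g => T g f)
    {κ : G → ℂ} (hκ : Integrable κ η) (f : V) : Integrable (fun g => κ g • T g f) η :=
  hκ.smul_bdd ‖f‖ (hc f).aestronglyMeasurable (.of_forall fun g => (hT g f).le)

variable [IsTopologicalGroup G] [SFinite η] [η.IsMulLeftInvariant] {κ₁ κ₂ : G → ℂ}

/-- The shear `(y, x) ↦ (y, y⁻¹ * x)` preserves the product measure, by left invariance. -/
theorem integrable_prod_mul_inv_mul (h₁ : Integrable κ₁ η) (h₂ : Integrable κ₂ η) :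
    Integrable (fun p : G × G => κ₂ p.1 * κ₁ (p.1⁻¹ * p.2)) (η.prod η) :=
  (measurePreserving_prod_inv_mul η η).integrable_comp_of_integrable (h₂.mul_prod h₁)

/-- Fubini's theorem, together with the substitution `x ↦ y * x` in the inner integral. -/
theorem integral_smul_rep_integral_smul_rep [CompleteSpace V] (hT : ∀ g f, ‖T g f‖ = ‖f‖)
    (hc : ∀ f, Continuous fun g => T g f) (h₁ : Integrable κ₁ η) (h₂ : Integrable κ₂ η) (f : V) :
    ∫ y, κ₂ y • T y (∫ x, κ₁ x • T x f ∂η) ∂η =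
      ∫ x, (∫ y, κ₂ y * κ₁ (y⁻¹ * x) ∂η) • T x f ∂η := by
  -- The integrand is dominated by that of the convolution, as `T` acts by isometries.
  have hF : Integrable (fun p : G × G => (κ₂ p.1 * κ₁ (p.1⁻¹ * p.2)) • T p.2 f) (η.prod η) :=
    (integrable_prod_mul_inv_mul h₁ h₂).smul_bdd ‖f‖
      ((hc f).comp continuous_snd).aestronglyMeasurable (.of_forall fun p => (hT p.2 f).le)
  calc ∫ y, κ₂ y • T y (∫ x, κ₁ x • T x f ∂η) ∂η
      = ∫ y, ∫ x, (κ₂ y * κ₁ (y⁻¹ * x)) • T x f ∂η ∂η := by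
        congr 1 with y
        rw [← ContinuousLinearMap.integral_comp_comm _ (integrable_smul_rep hT hc h₁ f),
          ← integral_smul, ← integral_mul_left_eq_self _ y⁻¹]
        congr 1 with x
        have hTx : T y (T (y⁻¹ * x) f) = T x f := by
          rw [← mul_apply_eq_comp, ← map_mul, mul_inv_cancel_left]
        rw [map_smul, hTx, smul_smul]
    _ = ∫ x, ∫ y, (κ₂ y * κ₁ (y⁻¹ * x)) • T x f ∂η ∂η := integral_integral_swap hF
    _ = ∫ x, (∫ y, κ₂ y * κ₁ (y⁻¹ * x) ∂η) • T x f ∂η := by simp only [integral_smul_const]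

end Convolution

/-! ### Exponential coordinates -/

section Coordinates

variable {E : Type*} [NormedAddCommGroup E] [NormedSpace ℝ E]
  {G : Type*} [TopologicalSpace G] [ChartedSpace E G] [Group G]
  {N : ℕ} (b : Module.Basis (Fin N) ℝ (GroupLieAlgebra 𝓘(ℝ, E) G))

/-- As `expCoord b` is a homeomorphism, `invMeasure b η` is the honest pullback of `η`, although
`Measure.comap` has a junk value for general maps. -/
theorem measurePreserving_expCoord [MeasurableSpace G] [BorelSpace G]
    (hb : IsHomeomorph (expCoord b)) (η : Measure G) :
    MeasurePreserving (hb.homeomorph.toMeasurableEquiv) (invMeasure b η) η := by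
  refine ⟨hb.homeomorph.toMeasurableEquiv.measurable, ?_⟩
  have h : invMeasure b η = η.comap hb.homeomorph.toMeasurableEquiv := rfl
  rw [h, hb.homeomorph.toMeasurableEquiv.measurableEmbedding.map_comap,
    hb.homeomorph.toMeasurableEquiv.surjective.range_eq, Measure.restrict_univ]

theorem CH_eq_iff (hb : Function.Bijective (expCoord b)) {x y z : Fin N → ℝ} :
    CH b x y = z ↔ expCoord b x * expCoord b y = expCoord b z := by
  rw [← hb.injective.eq_iff, CH, Function.rightInverse_invFun hb.surjective]

variable [FiniteDimensional ℝ E]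

theorem isHomeomorph_expCoord
    (hexp : IsHomeomorph (lieExp : GroupLieAlgebra 𝓘(ℝ, E) G → G)) :
    IsHomeomorph (expCoord b) := by
  have : T2Space (GroupLieAlgebra 𝓘(ℝ, E) G) := inferInstanceAs (T2Space E)
  have : FiniteDimensional ℝ (GroupLieAlgebra 𝓘(ℝ, E) G) := inferInstanceAs (FiniteDimensional ℝ E)
  have h : ofCoord b = b.equivFunL.symm := by
    ext x
    exact (b.equivFun_symm_apply x).symm
  change IsHomeomorph (lieExp ∘ ofCoord b)
  rw [h]
  exact hexp.comp b.equivFunL.symm.toHomeomorph.isHomeomorph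

theorem expCoord_neg [LieGroup 𝓘(ℝ, E) 3 G] [T2Space G] (x : Fin N → ℝ) :
    expCoord b (-x) = (expCoord b x)⁻¹ := by
  have : CompleteSpace E := FiniteDimensional.complete ℝ E
  rw [expCoord, expCoord, ← lieExp_neg]
  congr 1
  simp [ofCoord]

theorem expI_eq_rep [LieGroup 𝓘(ℝ, E) 3 G] [T2Space G]
    {V : Type*} [NormedAddCommGroup V] [NormedSpace ℂ V] [CompleteSpace V]
    {A : GroupLieAlgebra 𝓘(ℝ, E) G → V →ₗ.[ℂ] V} {T : G →* (V →L[ℂ] V)}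
    (hT : ∀ g f, ‖T g f‖ = ‖f‖) (hc : ∀ f, Continuous fun g => T g f)
    (hA : ∀ X, IsGenerator (A X) fun t : ℝ => T (lieExp (t • X)))
    (X : GroupLieAlgebra 𝓘(ℝ, E) G) : expI (A X) = T (lieExp X) := by
  have : CompleteSpace E := FiniteDimensional.complete ℝ E
  have hU : IsIsometricGroup fun t : ℝ => T (lieExp (t • X)) :=
    { zero := by simp [lieExp_zero, ContinuousLinearMap.one_def]
      add := fun s t => by rw [lieExp_add_smul, map_mul]; rfl
      norm_eq := fun t f => hT _ f
      continuous := fun f => (hc f).comp (continuous_lieExp_smul X) }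
  simpa using expI_eq hU (hA X)

end Coordinates

/-! ### The composition formula -/

/-- The composition formula for integrable kernels. Every integral is moved from `ℝ^N` to `G`
through exponential coordinates, where it is a statement about convolution. -/
theorem composition_formula
    {E : Type*} [NormedAddCommGroup E] [NormedSpace ℝ E] [FiniteDimensional ℝ E]
    {G : Type*} [TopologicalSpace G] [T2Space G] [ChartedSpace E G] [Group G]
    [LieGroup 𝓘(ℝ, E) 3 G] [MeasurableSpace G] [BorelSpace G]
    (hexp : IsHomeomorph (lieExp : GroupLieAlgebra 𝓘(ℝ, E) G → G))
    (η : Measure G) [η.IsHaarMeasure]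
    {N : ℕ} (b : Module.Basis (Fin N) ℝ (GroupLieAlgebra 𝓘(ℝ, E) G))
    {V : Type*} [NormedAddCommGroup V] [NormedSpace ℂ V] [CompleteSpace V]
    {A : GroupLieAlgebra 𝓘(ℝ, E) G → V →ₗ.[ℂ] V} (hA : IsSelfAdjointRep A)
    {κ₁ κ₂ : (Fin N → ℝ) → ℂ} (h₁ : Integrable κ₁ (invMeasure b η))
    (h₂ : Integrable κ₂ (invMeasure b η)) :
    (∀ᵐ x ∂invMeasure b η, Integrable (fun y => κ₂ y * κ₁ (CH b (-y) x)) (invMeasure b η)) ∧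
    Integrable (convCH b (invMeasure b η) κ₂ κ₁) (invMeasure b η) ∧
    (∀ κ, Integrable κ (invMeasure b η) → ∀ f : V,
      Integrable (integrand b A κ f) (invMeasure b η)) ∧
    ∀ f : V, expIntegral b (invMeasure b η) A κ₂ (expIntegral b (invMeasure b η) A κ₁ f) =
      expIntegral b (invMeasure b η) A (convCH b (invMeasure b η) κ₂ κ₁) f := by
  obtain ⟨T, hT, hc, hgen⟩ := hA
  have hh := isHomeomorph_expCoord b hexp
  have : IsTopologicalGroup G := topologicalGroup_of_lieGroup 𝓘(ℝ, E) 3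
  have : SecondCountableTopology G := hh.homeomorph.symm.secondCountableTopology
  have : LocallyCompactSpace G := hh.homeomorph.symm.isClosedEmbedding.locallyCompactSpace
  set e : (Fin N → ℝ) ≃ᵐ G := hh.homeomorph.toMeasurableEquiv
  have he_apply (x) : e x = expCoord b x := rfl
  have hμ : MeasurePreserving e (invMeasure b η) η := measurePreserving_expCoord b hh η
  set μ := invMeasure b η
  have hint (φ : G → ℂ) : Integrable (fun x => φ (e x)) μ ↔ Integrable φ η :=
    hμ.integrable_comp_emb e.measurableEmbedding
  have hintV (φ : G → V) : Integrable (fun x => φ (e x)) μ ↔ Integrable φ η :=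
    hμ.integrable_comp_emb e.measurableEmbedding
  have hrep (κ : (Fin N → ℝ) → ℂ) (f : V) :
      integrand b A κ f = fun x => (fun g => κ (e.symm g) • T g f) (e x) := by
    ext x
    simp only [integrand, expI_eq_rep hT hc hgen, MeasurableEquiv.symm_apply_apply]
    rfl
  have hker (κ : (Fin N → ℝ) → ℂ) : Integrable κ μ ↔ Integrable (fun g => κ (e.symm g)) η := by
    simpa using hint fun g => κ (e.symm g)
  have hconv (x : Fin N → ℝ) : (fun y => κ₂ y * κ₁ (CH b (-y) x)) =
      fun y => (fun g => κ₂ (e.symm g) * κ₁ (e.symm (g⁻¹ * e x))) (e y) := by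
    ext y
    have : CH b (-y) x = e.symm ((e y)⁻¹ * e x) := by
      rw [CH_eq_iff b hh.bijective, ← he_apply (e.symm _), e.apply_symm_apply, expCoord_neg]
      rfl
    simp [this]
  have hconv' : convCH b μ κ₂ κ₁ =
      fun x => cst N * ∫ g, κ₂ (e.symm g) * κ₁ (e.symm (g⁻¹ * e x)) ∂η := by
    ext x
    rw [convCH, hconv, hμ.integral_comp' fun g => κ₂ (e.symm g) * κ₁ (e.symm (g⁻¹ * e x))]
  have hprod := integrable_prod_mul_inv_mul ((hker κ₁).mp h₁) ((hker κ₂).mp h₂)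
  refine ⟨?_, ?_, ?_, fun f => ?_⟩
  · filter_upwards [hμ.quasiMeasurePreserving.ae hprod.prod_left_ae] with x hx
    rw [hconv, hint fun g => κ₂ (e.symm g) * κ₁ (e.symm (g⁻¹ * e x))]
    exact hx
  · rw [hconv']
    exact (hint fun h => cst N * ∫ g, κ₂ (e.symm g) * κ₁ (e.symm (g⁻¹ * h)) ∂η).mpr
      (hprod.integral_prod_right.const_mul _)
  · intro κ hκ f
    rw [hrep, hintV fun g => κ (e.symm g) • T g f]
    exact integrable_smul_rep hT hc ((hker κ).mp hκ) f
  · have hop (κ : (Fin N → ℝ) → ℂ) (f : V) :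
        expIntegral b μ A κ f = cst N • ∫ g, κ (e.symm g) • T g f ∂η := by
      rw [expIntegral, hrep, hμ.integral_comp' fun g => κ (e.symm g) • T g f]
    simp only [hop, hconv', e.apply_symm_apply, map_smul, mul_smul, integral_smul]
    rw [← integral_smul_rep_integral_smul_rep hT hc ((hker κ₁).mp h₁) ((hker κ₂).mp h₂) f]
    simp only [smul_comm (κ₂ _) (cst N), integral_smul]

end RelConv

theorem proposition3p1
    {E : Type*} [NormedAddCommGroup E] [NormedSpace ℝ E] [FiniteDimensional ℝ E]
    {G : Type*} [TopologicalSpace G] [T2Space G] [ChartedSpace E G] [Group G]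
    [LieGroup 𝓘(ℝ, E) ∞ G] [SimplyConnectedSpace G] [MeasurableSpace G] [BorelSpace G]
    (hexp : IsHomeomorph (RelConv.lieExp : GroupLieAlgebra 𝓘(ℝ, E) G → G))
    (η : Measure G) [η.IsHaarMeasure]
    {N : ℕ} (b : Module.Basis (Fin N) ℝ (GroupLieAlgebra 𝓘(ℝ, E) G))
    {V : Type*} [NormedAddCommGroup V] [NormedSpace ℂ V] [CompleteSpace V]
    (A : GroupLieAlgebra 𝓘(ℝ, E) G → V →ₗ.[ℂ] V) (hA : RelConv.IsSelfAdjointRep A)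
    (μ : Measure (Fin N → ℝ)) (hμ : μ = RelConv.invMeasure b η) :
    (∀ κ₁ κ₂ : (Fin N → ℝ) → ℂ, Integrable κ₁ μ → Integrable κ₂ μ →
      (∀ᵐ x ∂μ, Integrable (fun y => κ₂ y * κ₁ (RelConv.CH b (-y) x)) μ) ∧
      Integrable (RelConv.convCH b μ κ₂ κ₁) μ ∧
      (∀ f : V, Integrable (RelConv.integrand b A κ₁ f) μ ∧
        Integrable (RelConv.integrand b A κ₂ f) μ ∧
        Integrable (RelConv.integrand b A (RelConv.convCH b μ κ₂ κ₁) f) μ) ∧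
      ∀ f : V, RelConv.expIntegral b μ A κ₂ (RelConv.expIntegral b μ A κ₁ f) =
        RelConv.expIntegral b μ A (RelConv.convCH b μ κ₂ κ₁) f) ∧
    ∀ k₁ k₂ k : (Fin N → ℝ) → ℂ, Integrable k₁ → Integrable k₂ → Integrable k →
      Integrable (RelConv.fourier k₁) μ → Integrable (RelConv.fourier k₂) μ →
      RelConv.fourier k =ᵐ[μ] RelConv.convCH b μ (RelConv.fourier k₂) (RelConv.fourier k₁) →
      ∀ f : V, RelConv.relativeConvolution b μ A k₂ (RelConv.relativeConvolution b μ A k₁ f) =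
        RelConv.relativeConvolution b μ A k f := by
  have h3 : LieGroup 𝓘(ℝ, E) 3 G := LieGroup.of_le (n := ∞) ENat.LEInfty.out
  subst hμ
  constructor
  · intro κ₁ κ₂ h₁ h₂
    obtain ⟨h, hc, hi, heq⟩ := RelConv.composition_formula hexp η b hA h₁ h₂
    exact ⟨h, hc, fun f => ⟨hi _ h₁ f, hi _ h₂ f, hi _ hc f⟩, heq⟩
  · intro k₁ k₂ k _ _ _ h₁ h₂ hk f
    obtain ⟨-, -, -, heq⟩ := RelConv.composition_formula hexp η b hA h₁ h₂
    refine (heq f).trans (congrArg (RelConv.cst N • ·) (integral_congr_ae ?_))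
    filter_upwards [hk] with x hx
    simp only [RelConv.integrand, hx]
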